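/- **Theorem 5.1.** There is an incentive-compatible distributed mechanism that computes a $2$-approximation of minimum-weight vertex cover in $O(\Delta+\log^* n)$ rounds in the LOCAL model. In detail: the agents are the nodes of a finite simple graph $G=(V,E)$ with $n$ nodes and maximum degree $\Delta$, and $G$ is also the communication network. Each node $v$ has a private weight $w(v)\in\mathbb{R}_{\ge 0}$ and submits a bid $b(v)\in\mathbb{R}_{\ge 0}$. Nodes have distinct identifiers in $\{1,\dots,k n^k\}$, where $k$ is a fixed constant. For every $k$ there are a constant $C$ and one deterministic LOCAL algorithm (synchronous rounds, unbounded messages and local computation; initially a node knows only its identifier and its bid) such that for every $G$ and every assignment of identifiers: 1. for every bid vector $b$, all nodes stop within $C(\Delta+\log^* n+1)$ rounds, and each node $v$ announces whether it belongs to the selected set $S(b)\subseteq V$, and its payment $p_v(b)\in\mathbb{R}$; 2. (incentive compatibility) bidding the truth is a weakly dominant strategy: if the utility of $v$ is $p_v(b)-w(v)$ when $v\in S(b)$ and $p_v(b)$ otherwise, then for all bids of the other agents $v$ maximises its utility by bidding $b(v)=w(v)$; 3. (monotonicity) if $v\in S(b)$, then $v$ is still selected when it lowers its bid and all other bids stay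 the same; 4. (approximation) under truthful bids, $S(w)$ is a vertex cover of $G$, and $\sum_{v\in S(w)}w(v)\le 2\sum_{v\in S'}w(v)$ for every vertex cover $S'$ of $G$. -/

import Mathlib

open scoped NNReal

/-- The iterated logarithm `log* n`: the number of times the base-two logarithm has to be applied
to `n` before the value is at most `1`. Rounding up after each application does not change that
number, because `log₂ n ≤ 2^2^⋯^2` if and only if `⌈log₂ n⌉ ≤ 2^2^⋯^2`. -/
def logStar (n : ℕ) : ℕ :=
  if h : n ≤ 1 then 0 else logStar (Nat.clog 2 n) + 1
termination_by n
decreasing_by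
  have h1 : n ≤ 2 ^ (n - 1) := by
    have := Nat.lt_two_pow_self (n := n - 1)
    omega
  have h2 := Nat.clog_le_of_le_pow h1
  omega

/-- A deterministic algorithm in the LOCAL model of distributed computing, for nodes with local
inputs in `In` and local outputs in `Out`. States and messages are of arbitrary (in particular
unbounded) size, and local computation is unrestricted. All nodes run the same algorithm; a node
initially knows only its own identifier and its own input (neither the number of nodes, nor the
maximum degree, nor its own degree, nor any other part of the network).

In a round each node sends a message to its neighbours. Since messages are unbounded, it is no
restriction that all neighbours get the same message: it may consist of separate parts addressed
to neighbours by their identifiers. It may also contain the identifier of its sender. -/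
structure LocalAlgorithm (In Out : Type) where
  /-- the states of a node -/
  State : Type
  /-- the messages -/
  Msg : Type
  /-- the initial state, given the identifier and the input of the node -/
  init : ℕ → In → State
  /-- the message that a node sends to its neighbours, given its current state -/
  send : State → Msg
  /-- the next state, given the current state and the messages received from the neighbours -/
  receive : State → Multiset Msg → State
  /-- `output s = some y` if `s` is a stopping state in which the node announces the output `y`,
  and `output s = none` if `s` is not a stopping state -/
  output : State → Option Out

namespace LocalAlgorithm

variable {In Out V : Type}

/-- The state of each node after `t` synchronous rounds, in the network `G` with identifiers `ident`
and inputs `x`. A node that has stopped never changes its state again (so it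
relays no further information; its neighbours merely keep receiving its final message). -/
def run (A : LocalAlgorithm In Out) [Fintype V] (G : SimpleGraph V) [DecidableRel G.Adj]
    (ident : V → ℕ) (x : V → In) : ℕ → V → A.State
  | 0, v => A.init (ident v) (x v)
  | t + 1, v =>
    if (A.output (A.run G ident x t v)).isSome then A.run G ident x t v
    else A.receive (A.run G ident x t v)
      ((G.neighborFinset v).val.map fun u => A.send (A.run G ident x t u))

/-- Within `T` rounds all nodes have stopped, and node `v` has announced the output `y v`. -/
def ComputesWithin (A : LocalAlgorithm In Out) [Fintype V] (G : SimpleGraph V)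
    [DecidableRel G.Adj] (ident : V → ℕ) (x : V → In) (T : ℕ) (y : V → Out) : Prop :=
  ∀ v, A.output (A.run G ident x T v) = some (y v)

end LocalAlgorithm

/-- A (direct revelation) mechanism with agent set `V` for selecting a subset of the agents: from
the vector of bids it computes the set of selected agents and the payment made to each agent. -/
structure SelectionMechanism (V : Type) where
  /-- the allocation rule -/
  select : (V → ℝ≥0) → Finset V
  /-- the payments to the agents -/
  pay : (V → ℝ≥0) → V → ℝ

namespace SelectionMechanism

variable {V : Type} [DecidableEq V]

/-- The total utility of agent `v` under bids `b` when its true weight is `w`: being selected costs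
the agent its weight, and the payment is added. -/
def utility (M : SelectionMechanism V) (v : V) (w : ℝ≥0) (b : V → ℝ≥0) : ℝ :=
  (if v ∈ M.select b then -(w : ℝ) else 0) + M.pay b v

/-- Bidding the true weight is a weakly dominant strategy of every agent: whatever the bids of
the others, no bid `b v` gives agent `v` more utility than its true weight `w` does. -/
def IsIncentiveCompatible (M : SelectionMechanism V) : Prop :=
  ∀ (v : V) (w : ℝ≥0) (b : V → ℝ≥0), M.utility v w b ≤ M.utility v w (Function.update b v w)

/-- Monotonicity for a minimisation problem: a selected agent stays selected when it lowers its
bid and the other bids do not change. -/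
def IsMonotone (M : SelectionMechanism V) : Prop :=
  ∀ (v : V) (b : V → ℝ≥0) (x : ℝ≥0),
    v ∈ M.select b → x ≤ b v → v ∈ M.select (Function.update b v x)

end SelectionMechanism

/-- `S` is a vertex cover of `G` of weight at most `α` times the minimum weight of a vertex cover,
with respect to the node weights `w`. -/
def IsApproxMinVertexCover {V : Type} (G : SimpleGraph V) (w : V → ℝ≥0) (α : ℝ≥0)
    (S : Finset V) : Prop :=
  G.IsVertexCover (S : Set V) ∧
    ∀ S' : Finset V, G.IsVertexCover (S' : Set V) → ∑ v ∈ S, w v ≤ α * ∑ v ∈ S', w v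

/-! Put nonnegative amounts on the edges so that the sum at each node is at most its weight. Every
such edge packing bounds all vertex covers from below, so a cover by saturated nodes is
2-approximate (`sum_le_two_mul_sum_of_edge_packing`). The packing is greedy: an edge takes the
smaller residual weight of its endpoints, and exhausted nodes are selected. The order of the edges
does not depend on the bids: edges to smaller neighbours are split into at most Δ forests with 12
colours each, and a slot (forest, colour) handles disjoint stars.

While a node is not exhausted, each of its processed edges exhausts the other endpoint, however much
the node has left. So a losing node may raise its bid without affecting the others, and it still
loses (`resid_of_lower_bid`). Winning bids are therefore closed downwards; they are bounded by
`Selected.le_sum`, and paying winners their supremum is truthful.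

No node knows `n`, so each takes its number of colour reductions from its own identifier (`level`,
bounded through `colorDepth_poly_le`). Edges between levels are coloured by a parity instead
(`color_ne_parent`).

The algorithm is phrased as knowledge: a node keeps all worlds consistent with its messages. A node
that stops early falls silent, so `Agree` contains all that its neighbours may still need, for every
change of one bid, because payments depend on such counterfactual runs. The running time is then the
speed at which knowledge spreads (`Knows.succ`, `output_coverAlgorithm`). -/

/-! ### Number of colour reductions and the iterated logarithm -/

theorem two_mul_add_two_le_two_pow {d : ℕ} (hd : 3 ≤ d) : 2 * d + 2 ≤ 2 ^ d := by
  induction d, hd using Nat.le_induction with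
  | base => norm_num
  | succ d hd ih => rw [pow_succ]; omega

/-- For `d = (m - 1) / 2` both `m ≤ 2 * d + 2 ≤ 2 ^ d` and `2 * d < m` hold. The value 6 is a fixed
point of the map, so the reduction cannot go below it. -/
theorem two_mul_clog_lt {m : ℕ} (hm : 6 < m) : 2 * Nat.clog 2 m < m := by
  have h := two_mul_add_two_le_two_pow (d := (m - 1) / 2) (by omega)
  have := Nat.clog_le_of_le_pow (b := 2) (x := m) (y := (m - 1) / 2) (by omega)
  omega

/-- The number of rounds of colour reduction that turn colours below `m` into colours below `6`. -/
def colorDepth (m : ℕ) : ℕ :=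
  if h : m ≤ 6 then 0 else colorDepth (2 * Nat.clog 2 m) + 1
termination_by m
decreasing_by exact two_mul_clog_lt (by omega)

theorem colorDepth_of_le {m : ℕ} (h : m ≤ 6) : colorDepth m = 0 := by
  rw [colorDepth, dif_pos h]

theorem colorDepth_of_lt {m : ℕ} (h : 6 < m) :
    colorDepth m = colorDepth (2 * Nat.clog 2 m) + 1 := by
  rw [colorDepth, dif_neg (by omega)]

theorem colorDepth_le_succ (m : ℕ) : colorDepth m ≤ colorDepth (2 * Nat.clog 2 m) + 1 := by
  rcases le_or_gt m 6 with h | h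
  · simp [colorDepth_of_le h]
  · rw [colorDepth_of_lt h]

theorem colorDepth_mono {m m' : ℕ} (h : m ≤ m') : colorDepth m ≤ colorDepth m' := by
  induction m' using Nat.strong_induction_on generalizing m with
  | _ m' ih =>
    rcases le_or_gt m 6 with h6 | h6
    · simp [colorDepth_of_le h6]
    · rw [colorDepth_of_lt h6, colorDepth_of_lt (m := m') (by omega)]
      have := Nat.clog_mono_right 2 h
      have : colorDepth (2 * Nat.clog 2 m) ≤ colorDepth (2 * Nat.clog 2 m') :=
        ih _ (two_mul_clog_lt (by omega)) (by omega)
      omega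

theorem logStar_of_one_lt {n : ℕ} (h : 1 < n) : logStar n = logStar (Nat.clog 2 n) + 1 := by
  rw [logStar, dif_neg (by omega)]

/-- The invariant `y ≤ 2 ^ d * x` survives a simultaneous step: `2 * clog y ≤ 2 * d + 2 * clog x ≤ 2
^ d * clog x`, because `clog x ≥ 1` and `2 * d + 2 ≤ 2 ^ d`. -/
theorem colorDepth_le_logStar_add {d : ℕ} (hd : 3 ≤ d) {x y : ℕ} (h : y ≤ 2 ^ d * x) :
    colorDepth y ≤ logStar x + colorDepth (2 ^ d) := by
  induction x using Nat.strong_induction_on generalizing y with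
  | _ x ih =>
    rcases le_or_gt x 1 with h1 | h1
    · have : y ≤ 2 ^ d := h.trans (by nlinarith [Nat.zero_le (2 ^ d)])
      exact (colorDepth_mono this).trans (by omega)
    · have hc : 0 < Nat.clog 2 x := Nat.clog_pos (by norm_num) h1
      have hlt : Nat.clog 2 x < x := by
        have := Nat.lt_two_pow_self (n := x - 1)
        have := Nat.clog_le_of_le_pow (b := 2) (x := x) (y := x - 1) (by omega)
        omega
      have hy : Nat.clog 2 y ≤ d + Nat.clog 2 x := by
        refine Nat.clog_le_of_le_pow (h.trans ?_)
        rw [pow_add]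
        exact Nat.mul_le_mul_left _ (Nat.le_pow_clog (by norm_num) x)
      have hd2 := two_mul_add_two_le_two_pow hd
      have := ih _ hlt (y := 2 * Nat.clog 2 y) (by nlinarith)
      have := colorDepth_le_succ y
      rw [logStar_of_one_lt h1]
      omega

/-- One step turns a polynomial in `n` into at most `(4 * k + 4) * clog n`; from there the linear
comparison applies. -/
theorem colorDepth_poly_le (k n : ℕ) (hn : 1 ≤ n) :
    colorDepth (k * n ^ k + 2) ≤ logStar n + colorDepth (2 ^ (4 * k + 4)) := by
  have hk : k + 2 ≤ 2 ^ (k + 2) := Nat.lt_two_pow_self.le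
  rcases Nat.lt_or_ge 1 n with h1 | h1
  · have hc : 0 < Nat.clog 2 n := Nat.clog_pos (by norm_num) h1
    have hy : Nat.clog 2 (k * n ^ k + 2) ≤ (k + 2) + Nat.clog 2 n * k := by
      apply Nat.clog_le_of_le_pow
      have h2 : n ^ k ≤ 2 ^ (Nat.clog 2 n * k) := by
        rw [pow_mul]
        exact Nat.pow_le_pow_left (Nat.le_pow_clog (by norm_num) n) k
      have h3 : 1 ≤ n ^ k := Nat.one_le_pow _ _ hn
      rw [pow_add]
      calc k * n ^ k + 2 ≤ (k + 2) * n ^ k := by nlinarith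
        _ ≤ _ := Nat.mul_le_mul hk h2
    have hd : 4 * k + 4 ≤ 2 ^ (4 * k + 4) := Nat.lt_two_pow_self.le
    have := colorDepth_le_logStar_add (d := 4 * k + 4) (by omega) (x := Nat.clog 2 n)
      (y := 2 * Nat.clog 2 (k * n ^ k + 2)) (by nlinarith)
    have := colorDepth_le_succ (k * n ^ k + 2)
    rw [logStar_of_one_lt h1]
    omega
  · obtain rfl : n = 1 := by omega
    refine (colorDepth_mono ?_).trans (Nat.le_add_left _ _)
    have : 2 ^ (k + 2) ≤ 2 ^ (4 * k + 4) := Nat.pow_le_pow_right (by norm_num) (by omega)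
    simp only [one_pow, mul_one]
    omega

/-! ### The Cole–Vishkin step -/

theorem toNat_injective : Function.Injective Bool.toNat := by decide

/-- The lowest position at which two numbers have different binary digits. -/
noncomputable def firstDiff (x y : ℕ) : ℕ := sInf {j | x.testBit j ≠ y.testBit j}

theorem testBit_firstDiff {x y : ℕ} (h : x ≠ y) :
    x.testBit (firstDiff x y) ≠ y.testBit (firstDiff x y) :=
  Nat.sInf_mem (s := {j | x.testBit j ≠ y.testBit j}) (Nat.exists_testBit_ne_of_ne h)

/-- The colour reduction step of Cole and Vishkin, for a node of colour `x` whose parent has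
colour `y`. -/
noncomputable def coleVishkin (x y : ℕ) : ℕ :=
  2 * firstDiff x y + (x.testBit (firstDiff x y)).toNat

/-- Equal values would encode the same position and the same bit there, but `x` and `y` differ at
that position. -/
theorem coleVishkin_ne {x y z : ℕ} (hxy : x ≠ y) : coleVishkin x y ≠ coleVishkin y z := by
  intro h
  unfold coleVishkin at h
  have h1 := Bool.toNat_lt (x.testBit (firstDiff x y))
  have h2 := Bool.toNat_lt (y.testBit (firstDiff y z))
  have hd : firstDiff x y = firstDiff y z := by omega
  have hb : (x.testBit (firstDiff x y)).toNat = (y.testBit (firstDiff y z)).toNat := by omega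
  rw [← hd] at hb
  exact testBit_firstDiff hxy (toNat_injective hb)

/-- A root acts as if it had a parent that differs from it in bit 0. -/
theorem coleVishkin_ne_root {x y : ℕ} (hxy : x ≠ y) :
    coleVishkin x y ≠ (y.testBit 0).toNat := by
  intro h
  unfold coleVishkin at h
  have h2 := Bool.toNat_lt (y.testBit 0)
  have hd : firstDiff x y = 0 := by omega
  have := testBit_firstDiff hxy
  rw [hd] at h this
  exact this (toNat_injective (by omega))

theorem coleVishkin_lt {x y m : ℕ} (hxy : x ≠ y) (hx : x < m) (hy : y < m) :
    coleVishkin x y < 2 * Nat.clog 2 m := by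
  have hd : firstDiff x y < Nat.clog 2 m := by
    by_contra! h
    have hm : m ≤ 2 ^ firstDiff x y :=
      (Nat.le_pow_clog (by norm_num) m).trans (Nat.pow_le_pow_right (by norm_num) h)
    apply testBit_firstDiff hxy
    rw [Nat.testBit_lt_two_pow (hx.trans_le hm), Nat.testBit_lt_two_pow (hy.trans_le hm)]
  have := Bool.toNat_lt (x.testBit (firstDiff x y))
  unfold coleVishkin
  omega

/-! ### Forests and their 12-colouring -/

/-- The parent of node `a` in the `i`-th forest of a graph on `ℕ`: its `i`-th smaller neighbour. -/
noncomputable def parent (nb : ℕ → Finset ℕ) (i a : ℕ) : Option ℕ :=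
  ((nb a).filter (· < a)).toList[i]?

theorem parent_mem {nb : ℕ → Finset ℕ} {i a p : ℕ} (h : parent nb i a = some p) : p ∈ nb a := by
  have := List.mem_of_getElem? h
  simp at this
  exact this.1

theorem parent_lt {nb : ℕ → Finset ℕ} {i a p : ℕ} (h : parent nb i a = some p) : p < a := by
  have := List.mem_of_getElem? h
  simp at this
  exact this.2

theorem lt_card_of_parent {nb : ℕ → Finset ℕ} {i a p : ℕ} (h : parent nb i a = some p) :
    i < (nb a).card := by
  obtain ⟨hi, -⟩ := List.getElem?_eq_some_iff.1 h
  rw [Finset.length_toList] at hi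
  exact hi.trans_le (Finset.card_filter_le _ _)

theorem exists_parent_eq {nb : ℕ → Finset ℕ} {a p : ℕ} (h : p ∈ nb a) (hp : p < a) :
    ∃ i, parent nb i a = some p := by
  have : p ∈ ((nb a).filter (· < a)).toList := by simp [h, hp]
  exact List.mem_iff_getElem?.1 this

theorem parent_congr {nb nb' : ℕ → Finset ℕ} {a : ℕ} (h : nb a = nb' a) (i : ℕ) :
    parent nb i a = parent nb' i a := by
  unfold parent
  rw [h]

/-- The level of a node with identifier `a`, which determines how often it reduces its colour. -/
def level (a : ℕ) : ℕ := colorDepth (a + 2)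

theorem level_mono {a b : ℕ} (h : a ≤ b) : level a ≤ level b := colorDepth_mono (by omega)

/-- The colour of node `a` in the `i`-th forest after `t` reductions; edges between nodes of
different levels are ignored. -/
noncomputable def reducedColor (nb : ℕ → Finset ℕ) (i : ℕ) : ℕ → ℕ → ℕ
  | 0, a => a
  | t + 1, a =>
    match parent nb i a with
    | some p =>
      if level p = level a then coleVishkin (reducedColor nb i t a) (reducedColor nb i t p)
      else ((reducedColor nb i t a).testBit 0).toNat
    | none => ((reducedColor nb i t a).testBit 0).toNat

theorem reducedColor_ne {nb : ℕ → Finset ℕ} {i a p : ℕ} (hp : parent nb i a = some p)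
    (hl : level p = level a) (t : ℕ) : reducedColor nb i t a ≠ reducedColor nb i t p := by
  induction t generalizing a p with
  | zero => exact (parent_lt hp).ne'
  | succ t ih =>
    have h := ih hp hl
    simp only [reducedColor, hp, hl, if_true]
    split
    · split
      · exact coleVishkin_ne h
      · exact coleVishkin_ne_root h
    · exact coleVishkin_ne_root h

/-- Parents have smaller identifiers, so a bound for `a` also serves its ancestors. The bound stays
at least 2, which leaves room for the one-bit colour of a root. -/
theorem reducedColor_lt (nb : ℕ → Finset ℕ) (i t : ℕ) {a m : ℕ} (ha : a < m) (hm : 2 ≤ m) :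
    reducedColor nb i t a < (fun m => 2 * Nat.clog 2 m)^[t] m ∧
      2 ≤ (fun m => 2 * Nat.clog 2 m)^[t] m := by
  induction t generalizing a with
  | zero => exact ⟨ha, hm⟩
  | succ t ih =>
    rw [Function.iterate_succ_apply']
    obtain ⟨h1, h2⟩ := ih ha
    have hc : 0 < Nat.clog 2 ((fun m => 2 * Nat.clog 2 m)^[t] m) :=
      Nat.clog_pos (by norm_num) h2
    have hb := Bool.toNat_lt ((reducedColor nb i t a).testBit 0)
    refine ⟨?_, by omega⟩
    simp only [reducedColor]
    split
    · next p hp =>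
      split
      · next hl => exact coleVishkin_lt (reducedColor_ne hp hl t) h1 (ih ((parent_lt hp).trans ha)).1
      · omega
    · omega

theorem iterate_colorDepth_le (m : ℕ) : (fun m => 2 * Nat.clog 2 m)^[colorDepth m] m ≤ 6 := by
  induction m using Nat.strong_induction_on with
  | _ m ih =>
    rcases le_or_gt m 6 with h | h
    · simpa [colorDepth_of_le h] using h
    · rw [colorDepth_of_lt h, Function.iterate_succ_apply]
      exact ih _ (two_mul_clog_lt h)

/-- The parity of the number of edges from `a` upwards in the `i`-th forest along which the level
drops, until the first edge on which it does not. -/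
noncomputable def levelParity (nb : ℕ → Finset ℕ) (i a : ℕ) : Bool :=
  match _ : parent nb i a with
  | some p => if level p < level a then !levelParity nb i p else false
  | none => false
termination_by a
decreasing_by exact parent_lt ‹_›

theorem levelParity_of_lt {nb : ℕ → Finset ℕ} {i a p : ℕ} (hp : parent nb i a = some p)
    (hl : level p < level a) : levelParity nb i a = !levelParity nb i p := by
  rw [levelParity]
  split
  · next q hq =>
    obtain rfl : q = p := by simpa [hp] using hq.symm
    rw [if_pos hl]
  · next h => simp [hp] at h

theorem levelParity_of_not_lt {nb : ℕ → Finset ℕ} {i a : ℕ}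
    (h : ∀ p, parent nb i a = some p → ¬ level p < level a) : levelParity nb i a = false := by
  rw [levelParity]
  split
  · next q hq => rw [if_neg (h q hq)]
  · rfl

/-- The colour of node `a` in the `i`-th forest. -/
noncomputable def color (nb : ℕ → Finset ℕ) (i a : ℕ) : ℕ :=
  6 * (levelParity nb i a).toNat + reducedColor nb i (level a) a

theorem reducedColor_level_lt (nb : ℕ → Finset ℕ) (i a : ℕ) :
    reducedColor nb i (level a) a < 6 :=
  (reducedColor_lt nb i (level a) (m := a + 2) (by omega) (by omega)).1.trans_le
    (iterate_colorDepth_le (a + 2))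

theorem color_lt (nb : ℕ → Finset ℕ) (i a : ℕ) : color nb i a < 12 := by
  have := reducedColor_level_lt nb i a
  have := Bool.toNat_lt (levelParity nb i a)
  unfold color
  omega

/-- Levels grow with identifiers. If the level drops towards the parent, the parities differ; if it
is the same, both nodes make equally many reductions and the reduced colours differ. -/
theorem color_ne_parent {nb : ℕ → Finset ℕ} {i a p : ℕ} (hp : parent nb i a = some p) :
    color nb i a ≠ color nb i p := by
  have h1 := reducedColor_level_lt nb i a
  have h2 := reducedColor_level_lt nb i p
  unfold color
  rcases (level_mono (parent_lt hp).le).lt_or_eq with hl | hl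
  · rw [levelParity_of_lt hp hl]
    cases levelParity nb i p <;> simp <;> omega
  · have := reducedColor_ne hp hl (level a)
    rw [hl] at h2 ⊢
    have := Bool.toNat_lt (levelParity nb i a)
    have := Bool.toNat_lt (levelParity nb i p)
    omega

/-! ### Greedy packing along stars -/

/-- The neighbours of `a` whose parent in the `i`-th forest is `a`. -/
noncomputable def children (nb : ℕ → Finset ℕ) (i a : ℕ) : Finset ℕ :=
  (nb a).filter (fun u => parent nb i u = some a)

/-- The leaves of the star centred at `a` that is processed in slot `s`. Slot `s` belongs to
forest `s / 12` and to colour `s % 12` of the centres. -/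
noncomputable def leaves (nb : ℕ → Finset ℕ) (s a : ℕ) : Finset ℕ :=
  if color nb (s / 12) a = s % 12 then children nb (s / 12) a else ∅

/-- The centre of the star processed in slot `s` in which `a` is a leaf. -/
noncomputable def host (nb : ℕ → Finset ℕ) (s a : ℕ) : Option ℕ :=
  (parent nb (s / 12) a).filter (fun p => color nb (s / 12) p = s % 12)

/-- The residual weights before slot `s`, from the initial weights `β`. In a slot the edges of each
star are processed in the order of the leaves, and each edge lowers the residual weights of both
endpoints by the smaller of the two. -/
noncomputable def resid (nb : ℕ → Finset ℕ) (β : ℕ → ℝ≥0) : ℕ → ℕ → ℝ≥0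
  | 0, a => β a
  | s + 1, a =>
    resid nb β s a - ∑ u ∈ leaves nb s a, resid nb β s u -
      (host nb s a).elim 0 fun p =>
        resid nb β s p - ∑ u ∈ (leaves nb s p).filter (· < a), resid nb β s u

/-- The residual weight of the centre `p` in slot `s` when it is the turn of the leaf `a`. -/
noncomputable def offer (nb : ℕ → Finset ℕ) (β : ℕ → ℝ≥0) (s p a : ℕ) : ℝ≥0 :=
  resid nb β s p - ∑ u ∈ (leaves nb s p).filter (· < a), resid nb β s u

/-- Node `a` enters the vertex cover. -/
def Selected (nb : ℕ → Finset ℕ) (β : ℕ → ℝ≥0) (a : ℕ) : Prop := ∃ s, resid nb β s a = 0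

section

variable {nb : ℕ → Finset ℕ} {β β' : ℕ → ℝ≥0} {s a p u : ℕ}

theorem host_eq_some :
    host nb s a = some p ↔
      parent nb (s / 12) a = some p ∧ color nb (s / 12) p = s % 12 := by
  simp [host, Option.filter_eq_some_iff]

theorem mem_leaves :
    u ∈ leaves nb s a ↔ u ∈ nb a ∧ host nb s u = some a := by
  rw [host_eq_some, leaves]
  split <;> simp [children, *]

theorem mem_leaves_iff_host (hs : ∀ a b, a ∈ nb b → b ∈ nb a) :
    u ∈ leaves nb s a ↔ host nb s u = some a := by
  rw [mem_leaves, and_iff_right_iff_imp]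
  exact fun h => hs _ _ (parent_mem (host_eq_some.1 h).1)

/-- All centres of a slot have the same colour and a leaf differs in colour from its centre, so no
node is both leaf and centre. -/
theorem leaves_eq_empty_of_host (h : host nb s a = some p) : leaves nb s a = ∅ := by
  rw [host_eq_some] at h
  rw [leaves, if_neg]
  intro hc
  exact color_ne_parent h.1 (hc.trans h.2.symm)

theorem host_ne_self : host nb s a ≠ some a := fun h =>
  (parent_lt (host_eq_some.1 h).1).ne rfl

theorem resid_succ_of_host (h : host nb s a = some p) :
    resid nb β (s + 1) a = resid nb β s a - offer nb β s p a := by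
  simp [resid, h, leaves_eq_empty_of_host h, offer]

theorem resid_succ_of_host_none (h : host nb s a = none) :
    resid nb β (s + 1) a = resid nb β s a - ∑ u ∈ leaves nb s a, resid nb β s u := by
  simp [resid, h]

theorem resid_antitone (nb : ℕ → Finset ℕ) (β : ℕ → ℝ≥0) (a : ℕ) :
    Antitone fun s => resid nb β s a :=
  antitone_nat_of_succ_le fun _ => tsub_le_self.trans tsub_le_self

theorem sum_filter_lt_add_le {L : Finset ℕ} (hu : u ∈ L) (r : ℕ → ℝ≥0) :
    ∑ x ∈ L.filter (· < u), r x + r u ≤ ∑ x ∈ L, r x := by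
  rw [add_comm, ← Finset.sum_insert (by simp)]
  apply Finset.sum_le_sum_of_subset
  intro x hx
  rcases Finset.mem_insert.1 hx with rfl | hx
  · exact hu
  · exact (Finset.mem_filter.1 hx).1

theorem sum_filter_lt_add_le_sum_filter_lt {L : Finset ℕ} (hu : u ∈ L) (hua : u < a)
    (r : ℕ → ℝ≥0) :
    ∑ x ∈ L.filter (· < u), r x + r u ≤ ∑ x ∈ L.filter (· < a), r x := by
  refine le_trans (le_of_eq ?_)
    (sum_filter_lt_add_le (L := L.filter (· < a)) (u := u) (by simp [hu, hua]) r)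
  rw [Finset.filter_filter]
  congr 2
  refine Finset.filter_congr fun x _ => ?_
  exact ⟨fun h => ⟨h.trans hua, h⟩, fun h => h.2⟩

/-- Serving the leaves one after another from the supply `R` spends the same total as serving them
at once. The induction adds the last leaf. -/
theorem sum_min_tsub_eq_min (L : Finset ℕ) (r : ℕ → ℝ≥0) (R : ℝ≥0) :
    ∑ u ∈ L, min (r u) (R - ∑ x ∈ L.filter (· < u), r x) = min R (∑ u ∈ L, r u) := by
  induction L using Finset.induction_on_max with
  | empty => simp
  | insert a s hs ih =>
    have ha : a ∉ s := fun h => (hs a h).ne rfl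
    rw [Finset.sum_insert ha, Finset.sum_insert ha]
    have h1 : (insert a s).filter (· < a) = s := by
      ext x
      have := hs x
      simp only [Finset.mem_filter, Finset.mem_insert]
      constructor
      · rintro ⟨rfl | h, h'⟩
        · omega
        · exact h
      · exact fun h => ⟨Or.inr h, hs x h⟩
    have h2 : ∀ u ∈ s, (insert a s).filter (· < u) = s.filter (· < u) := by
      intro u hu
      rw [Finset.filter_insert, if_neg (hs u hu).not_gt]
    have h3 : ∑ u ∈ s, min (r u) (R - ∑ x ∈ (insert a s).filter (· < u), r x) =
        min R (∑ u ∈ s, r u) := by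
      rw [← ih]
      exact Finset.sum_congr rfl fun u hu => by rw [h2 u hu]
    rw [h1, h3]
    rcases le_total R (∑ u ∈ s, r u) with h | h
    · rw [tsub_eq_zero_of_le h, min_eq_left h, min_eq_left (h.trans le_add_self)]
      simp
    · rw [min_eq_right h]
      obtain ⟨c, rfl⟩ := exists_add_of_le h
      rw [add_tsub_cancel_left, add_comm (r a), min_add_add_left, min_comm, add_comm]

/-! ### Monotonicity -/

/-- A lower bid of a node that never has residual weight zero does not influence the others. -/
theorem resid_of_lower_bid (hs : ∀ a b, a ∈ nb b → b ∈ nb a) (ha : β' a ≤ β a)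
    (hne : ∀ c, c ≠ a → β' c = β c) (hpos : ∀ s, resid nb β' s a ≠ 0) (s : ℕ) :
    resid nb β' s a ≤ resid nb β s a ∧ ∀ c, c ≠ a → resid nb β' s c = resid nb β s c := by
  induction s with
  | zero => exact ⟨ha, hne⟩
  | succ s ih =>
    obtain ⟨iha, ihc⟩ := ih
    have hsum : ∀ L : Finset ℕ, a ∉ L →
        ∑ u ∈ L, resid nb β' s u = ∑ u ∈ L, resid nb β s u := fun L hL =>
      Finset.sum_congr rfl fun u hu => ihc u fun h => hL (h ▸ hu)
    have hoff : ∀ q c, q ≠ a → a ∉ (leaves nb s q).filter (· < c) →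
        offer nb β' s q c = offer nb β s q c := by
      intro q c hq h
      rw [offer, offer, ihc q hq, hsum _ h]
    have hp1 := hpos (s + 1)
    cases hh : host nb s a with
    | some p =>
      have hpa : p ≠ a := fun h => host_ne_self (h ▸ hh)
      have hap : a ∈ leaves nb s p := (mem_leaves_iff_host hs).2 hh
      rw [resid_succ_of_host hh] at hp1 ⊢
      rw [resid_succ_of_host hh]
      have ho := hoff p a hpa (by simp)
      refine ⟨ho ▸ tsub_le_tsub_right iha _, fun c hc => ?_⟩
      -- The leaf `a` keeps a positive residual, so its edge exhausts the centre `p`. This remains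
      -- true under the higher bid, so `p` and the later leaves see no difference.
      have hlt : resid nb β' s p ≤
          ∑ u ∈ (leaves nb s p).filter (· < a), resid nb β' s u + resid nb β' s a := by
        rw [← tsub_le_iff_left]
        exact (lt_of_not_ge fun h => hp1 (tsub_eq_zero_of_le h)).le
      have hlt2 : resid nb β s p ≤
          ∑ u ∈ (leaves nb s p).filter (· < a), resid nb β s u + resid nb β s a := by
        rw [← ihc p hpa, ← hsum _ (by simp)]
        exact hlt.trans (by gcongr)
      cases hhc : host nb s c with
      | none =>
        rw [resid_succ_of_host_none hhc, resid_succ_of_host_none hhc]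
        by_cases hac : a ∈ leaves nb s c
        · obtain rfl : p = c := by
            have := (mem_leaves_iff_host hs).1 hac
            simpa [hh] using this
          rw [tsub_eq_zero_of_le (hlt.trans (sum_filter_lt_add_le hap _)),
            tsub_eq_zero_of_le (hlt2.trans (sum_filter_lt_add_le hap _))]
        · rw [ihc c hc, hsum _ hac]
      | some q =>
        have hqa : q ≠ a := by
          rintro rfl
          have := (mem_leaves_iff_host hs).2 hhc
          simp [leaves_eq_empty_of_host hh] at this
        rw [resid_succ_of_host hhc, resid_succ_of_host hhc, ihc c hc]
        by_cases hac : a ∈ (leaves nb s q).filter (· < c)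
        · rw [Finset.mem_filter] at hac
          obtain rfl : p = q := by
            have := (mem_leaves_iff_host hs).1 hac.1
            simpa [hh] using this
          rw [offer, offer,
            tsub_eq_zero_of_le (hlt.trans (sum_filter_lt_add_le_sum_filter_lt hap hac.2 _)),
            tsub_eq_zero_of_le (hlt2.trans (sum_filter_lt_add_le_sum_filter_lt hap hac.2 _))]
        · rw [hoff q c hqa hac]
    | none =>
      have hnl : ∀ q, a ∉ leaves nb s q := by
        intro q h
        have := (mem_leaves_iff_host hs).1 h
        simp [hh] at this
      rw [resid_succ_of_host_none hh] at hp1 ⊢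
      rw [resid_succ_of_host_none hh]
      refine ⟨hsum _ (hnl a) ▸ tsub_le_tsub_right iha _, fun c hc => ?_⟩
      -- As a centre with weight left over, `a` exhausts all of its leaves, under either bid.
      have hlt : ∑ u ∈ leaves nb s a, resid nb β' s u ≤ resid nb β' s a :=
        (lt_of_not_ge fun h => hp1 (tsub_eq_zero_of_le h)).le
      have hlt2 : ∑ u ∈ leaves nb s a, resid nb β s u ≤ resid nb β s a := by
        rw [← hsum _ (hnl a)]
        exact hlt.trans iha
      cases hhc : host nb s c with
      | none =>
        rw [resid_succ_of_host_none hhc, resid_succ_of_host_none hhc, ihc c hc, hsum _ (hnl c)]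
      | some q =>
        rw [resid_succ_of_host hhc, resid_succ_of_host hhc]
        by_cases hq : q = a
        · subst hq
          have hcq : c ∈ leaves nb s q := (mem_leaves_iff_host hs).2 hhc
          have key : ∀ r : ℕ → ℝ≥0, ∑ u ∈ leaves nb s q, r u ≤ r q →
              r c - (r q - ∑ u ∈ (leaves nb s q).filter (· < c), r u) = 0 := by
            intro r hr
            exact tsub_eq_zero_of_le (le_tsub_of_add_le_left
              ((sum_filter_lt_add_le hcq r).trans hr))
          rw [offer, offer, key _ hlt, key _ hlt2]
        · rw [ihc c hc, hoff q c hq (by simp [hnl])]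

theorem Selected.lower_bid (hs : ∀ a b, a ∈ nb b → b ∈ nb a) (ha : β' a ≤ β a)
    (hne : ∀ c, c ≠ a → β' c = β c) (h : Selected nb β a) : Selected nb β' a := by
  by_contra hcon
  obtain ⟨s, h0⟩ := h
  have hpos : ∀ s, resid nb β' s a ≠ 0 := fun s hz => hcon ⟨s, hz⟩
  have := (resid_of_lower_bid hs ha hne hpos s).1
  rw [h0] at this
  exact hpos s (le_zero_iff.1 this)

/-! ### Edge packing, cover and duality -/

/-- The amount by which slot `s` lowers the residual weights of a leaf `a` and a centre `p`. -/
noncomputable def slotFlow (nb : ℕ → Finset ℕ) (β : ℕ → ℝ≥0) (s a p : ℕ) : ℝ≥0 :=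
  if host nb s a = some p then min (resid nb β s a) (offer nb β s p a) else 0

/-- A node acts either as a leaf or as a centre, never both; in each case truncated subtraction
removes exactly the minimum of residual and demand. -/
theorem resid_eq_resid_succ_add (hs : ∀ a b, a ∈ nb b → b ∈ nb a) (β : ℕ → ℝ≥0) (s a : ℕ) :
    resid nb β s a =
      resid nb β (s + 1) a + ∑ u ∈ nb a, (slotFlow nb β s a u + slotFlow nb β s u a) := by
  cases hh : host nb s a with
  | some p =>
    have hna : ∀ u, slotFlow nb β s u a = 0 := by
      intro u
      rw [slotFlow, if_neg]
      intro h
      have := (mem_leaves_iff_host hs).2 h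
      simp [leaves_eq_empty_of_host hh] at this
    have hp : p ∈ nb a := parent_mem (host_eq_some.1 hh).1
    have hsum : ∑ u ∈ nb a, (slotFlow nb β s a u + slotFlow nb β s u a)
        = min (resid nb β s a) (offer nb β s p a) := by
      rw [Finset.sum_eq_single_of_mem p hp]
      · rw [hna, add_zero, slotFlow, if_pos hh]
      · intro u _ hu
        rw [hna, add_zero, slotFlow, if_neg (by simp [hh, hu.symm])]
    rw [hsum, resid_succ_of_host hh, tsub_add_min]
  | none =>
    have hsum : ∑ u ∈ nb a, (slotFlow nb β s a u + slotFlow nb β s u a)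
        = min (resid nb β s a) (∑ u ∈ leaves nb s a, resid nb β s u) := by
      rw [← sum_min_tsub_eq_min]
      have hsub : leaves nb s a ⊆ nb a := fun u hu => (mem_leaves.1 hu).1
      rw [← Finset.sum_subset hsub]
      · refine Finset.sum_congr rfl fun u hu => ?_
        simp [slotFlow, hh, mem_leaves.1 hu, offer]
      · intro u hu hul
        have : host nb s u ≠ some a := fun h => hul (mem_leaves.2 ⟨hu, h⟩)
        simp [slotFlow, hh, this]
    rw [hsum, resid_succ_of_host_none hh, tsub_add_min]

/-- The total decrease of the residual weights is given by an edge packing. -/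
theorem exists_edge_packing (hs : ∀ a b, a ∈ nb b → b ∈ nb a) (β : ℕ → ℝ≥0) (s : ℕ) :
    ∃ z : ℕ → ℕ → ℝ≥0, (∀ a u, z a u = z u a) ∧
      ∀ a, β a = resid nb β s a + ∑ u ∈ nb a, z a u := by
  induction s with
  | zero => exact ⟨fun _ _ => 0, fun _ _ => rfl, fun a => by simp [resid]⟩
  | succ s ih =>
    obtain ⟨z, hz, hzs⟩ := ih
    refine ⟨fun a u => (slotFlow nb β s a u + slotFlow nb β s u a) + z a u,
      fun a u => by simp only [hz a u, add_comm (slotFlow nb β s a u)], fun a => ?_⟩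
    rw [hzs a, resid_eq_resid_succ_add hs β s a, Finset.sum_add_distrib (g := z a), add_assoc]

/-- The packing saturates `a`, and each edge at `a` carries at most the bid of its other endpoint.
-/
theorem Selected.le_sum (hs : ∀ a b, a ∈ nb b → b ∈ nb a) (h : Selected nb β a) :
    β a ≤ ∑ u ∈ nb a, β u := by
  obtain ⟨s, h⟩ := h
  obtain ⟨z, hz, hzs⟩ := exists_edge_packing hs β s
  rw [hzs a, h, zero_add]
  refine Finset.sum_le_sum fun u hu => ?_
  rw [hzs u, hz]
  exact le_add_left (Finset.single_le_sum (f := z u) (fun _ _ => zero_le) (hs _ _ hu))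

/-- In the slot given by the forest of the edge and the colour of its centre, either the centre runs
out or all leaves of the star do. -/
theorem selected_of_adj (hs : ∀ a b, a ∈ nb b → b ∈ nb a) (hp : p ∈ nb a) (hpa : p < a) :
    Selected nb β a ∨ Selected nb β p := by
  obtain ⟨i, hi⟩ := exists_parent_eq hp hpa
  have hc := color_lt nb i p
  have hdiv : (12 * i + color nb i p) / 12 = i := by omega
  have hmod : (12 * i + color nb i p) % 12 = color nb i p := by omega
  have hh : host nb (12 * i + color nb i p) a = some p := by
    rw [host_eq_some, hdiv, hmod]
    exact ⟨hi, rfl⟩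
  generalize 12 * i + color nb i p = s at hh
  have hal : a ∈ leaves nb s p := (mem_leaves_iff_host hs).2 hh
  have hhp : host nb s p = none := by
    cases hq : host nb s p with
    | none => rfl
    | some q => simp [leaves_eq_empty_of_host hq] at hal
  rcases le_total (resid nb β s p) (∑ u ∈ leaves nb s p, resid nb β s u) with h | h
  · right
    exact ⟨s + 1, by rw [resid_succ_of_host_none hhp, tsub_eq_zero_of_le h]⟩
  · left
    refine ⟨s + 1, ?_⟩
    rw [resid_succ_of_host hh, offer]
    exact tsub_eq_zero_of_le (le_tsub_of_add_le_left ((sum_filter_lt_add_le hal _).trans h))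

theorem resid_eq_of_inactive {D : ℕ} (hc : ∀ i, D ≤ i → children nb i a = ∅)
    (hp : ∀ i, D ≤ i → parent nb i a = none) (h : 12 * D ≤ s) :
    resid nb β s a = resid nb β (12 * D) a := by
  induction s, h using Nat.le_induction with
  | base => rfl
  | succ s h ih =>
    have hi : D ≤ s / 12 := by omega
    rw [resid_succ_of_host_none (by simp [host, hp _ hi]), ← ih]
    simp [leaves, hc _ hi]

theorem offer_eq_of_inactive {D : ℕ} (hc : ∀ i, D ≤ i → children nb i p = ∅)
    (h : 12 * D ≤ s) : offer nb β s p a = resid nb β s p := by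
  have hi : D ≤ s / 12 := by omega
  simp [offer, leaves, hc _ hi]

end

/-- Weak duality: summing the packing over all nodes counts each edge twice, and each edge has an
endpoint in `S'`. -/
theorem sum_le_two_mul_sum_of_edge_packing {V : Type} [Fintype V] [DecidableEq V]
    (G : SimpleGraph V) [DecidableRel G.Adj] (w : V → ℝ≥0) (z : V → V → ℝ≥0)
    (hz : ∀ u v, z u v = z v u) (hw : ∀ v, ∑ u ∈ G.neighborFinset v, z v u ≤ w v)
    (S S' : Finset V) (hS : ∀ v ∈ S, w v ≤ ∑ u ∈ G.neighborFinset v, z v u)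
    (hS' : G.IsVertexCover (S' : Set V)) : ∑ v ∈ S, w v ≤ 2 * ∑ v ∈ S', w v := by
  have hswap : ∑ v, ∑ u ∈ G.neighborFinset v, (if u ∈ S' then z v u else 0) =
      ∑ v ∈ S', ∑ u ∈ G.neighborFinset v, z v u := by
    simp only [SimpleGraph.neighborFinset_eq_filter, Finset.sum_filter]
    rw [Finset.sum_comm, ← Finset.univ_inter S', ← Finset.sum_ite_mem]
    refine Finset.sum_congr rfl fun v _ => ?_
    by_cases h : v ∈ S' <;> simp [h, G.adj_comm v, hz v]
  calc ∑ v ∈ S, w v ≤ ∑ v ∈ S, ∑ u ∈ G.neighborFinset v, z v u := Finset.sum_le_sum hS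
    _ ≤ ∑ v, ∑ u ∈ G.neighborFinset v, z v u :=
        Finset.sum_le_sum_of_subset (Finset.subset_univ _)
    _ ≤ ∑ v, ∑ u ∈ G.neighborFinset v,
          ((if v ∈ S' then z v u else 0) + (if u ∈ S' then z v u else 0)) := by
        refine Finset.sum_le_sum fun v _ => Finset.sum_le_sum fun u hu => ?_
        rw [SimpleGraph.mem_neighborFinset] at hu
        rcases hS' hu with h | h
        · rw [if_pos (show v ∈ S' from h)]; exact le_self_add
        · rw [if_pos (show u ∈ S' from h)]; exact le_add_self
    _ = 2 * ∑ v ∈ S', ∑ u ∈ G.neighborFinset v, z v u := by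
        simp only [Finset.sum_add_distrib]
        rw [hswap, two_mul]
        congr 1
        rw [← Finset.univ_inter S', ← Finset.sum_ite_mem]
        refine Finset.sum_congr rfl fun v _ => ?_
        by_cases h : v ∈ S' <;> simp [h]
    _ ≤ 2 * ∑ v ∈ S', w v := by gcongr with v _; exact hw v

/-! ### The algorithm as reasoning about possible worlds -/

/-- A graph on the identifiers, given by the sets of neighbours, together with a bid for each
identifier. -/
abbrev World : Type := (ℕ → Finset ℕ) × (ℕ → ℝ≥0)

/-- The worlds `w` and `w'` agree on all quantities that belong to node `a`: its neighbours, its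
role in the forests, and its part in the computation, if the bid of any one node is changed. -/
structure Agree (a : ℕ) (w w' : World) : Prop where
  bid : w.2 a = w'.2 a
  nbrs : w.1 a = w'.1 a
  children : ∀ i, children w.1 i a = children w'.1 i a
  reducedColor : ∀ i t, t ≤ level a → reducedColor w.1 i t a = reducedColor w'.1 i t a
  levelParity : ∀ i, levelParity w.1 i a = levelParity w'.1 i a
  hostColor : ∀ i, (parent w.1 i a).map (color w.1 i) = (parent w'.1 i a).map (color w'.1 i)
  resid : ∀ s z x, resid w.1 (Function.update w.2 z x) s a =
    resid w'.1 (Function.update w'.2 z x) s a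
  offer : ∀ s u z x, offer w.1 (Function.update w.2 z x) s a u =
    offer w'.1 (Function.update w'.2 z x) s a u

theorem Agree.of_left {a : ℕ} {w w₁ w₂ : World} (h₁ : Agree a w w₁) (h₂ : Agree a w w₂) :
    Agree a w₁ w₂ where
  bid := h₁.bid.symm.trans h₂.bid
  nbrs := h₁.nbrs.symm.trans h₂.nbrs
  children i := (h₁.children i).symm.trans (h₂.children i)
  reducedColor i t ht := (h₁.reducedColor i t ht).symm.trans (h₂.reducedColor i t ht)
  levelParity i := (h₁.levelParity i).symm.trans (h₂.levelParity i)
  hostColor i := (h₁.hostColor i).symm.trans (h₂.hostColor i)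
  resid s z x := (h₁.resid s z x).symm.trans (h₂.resid s z x)
  offer s u z x := (h₁.offer s u z x).symm.trans (h₂.offer s u z x)

open Classical in
/-- Whether node `a` is selected in the world `w`, and its payment: a selected node is paid the
threshold for its bid. -/
noncomputable def verdict (a : ℕ) (w : World) : Bool × ℝ :=
  (decide (Selected w.1 w.2 a),
    if Selected w.1 w.2 a then
      ((sSup {x : ℝ≥0 | Selected w.1 (Function.update w.2 a x) a} : ℝ≥0) : ℝ) else 0)

theorem verdict_snd_of_selected {a : ℕ} {w : World} (h : Selected w.1 w.2 a) :
    (verdict a w).2 =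
      ((sSup {x : ℝ≥0 | Selected w.1 (Function.update w.2 a x) a} : ℝ≥0) : ℝ) := by
  rw [verdict, if_pos h]

theorem verdict_snd_of_not_selected {a : ℕ} {w : World} (h : ¬ Selected w.1 w.2 a) :
    (verdict a w).2 = 0 := by
  rw [verdict, if_neg h]

theorem Agree.verdict_eq {a : ℕ} {w w' : World} (h : Agree a w w') :
    verdict a w = verdict a w' := by
  have h1 : ∀ x, Selected w.1 (Function.update w.2 a x) a ↔
      Selected w'.1 (Function.update w'.2 a x) a := by
    intro x
    simp only [Selected, h.resid]
  have h2 : Selected w.1 w.2 a ↔ Selected w'.1 w'.2 a := by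
    have := h1 (w.2 a)
    rwa [Function.update_eq_self, h.bid, Function.update_eq_self] at this
  simp only [verdict, h1]
  by_cases h3 : Selected w.1 w.2 a
  · simp [h3, h2.1 h3]
  · simp [h3, mt h2.2 h3]

open Classical in
/-- What node `a` announces if it considers the worlds in `K` possible: nothing, unless these worlds
agree on the quantities that belong to `a`. -/
noncomputable def announce (a : ℕ) (K : Set World) : Option (Bool × ℝ) :=
  if h : ∃ w ∈ K, ∀ w' ∈ K, Agree a w w' then some (verdict a h.choose) else none

/-- The chosen world is immaterial: worlds that agree with a common world agree with each other. -/
theorem announce_eq_some {a : ℕ} {K : Set World} {y : Bool × ℝ} {w : World} (hw : w ∈ K)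
    (h : announce a K = some y) : (∀ w' ∈ K, Agree a w w') ∧ y = verdict a w := by
  unfold announce at h
  split at h
  · next hex =>
    obtain ⟨-, h2⟩ := hex.choose_spec
    exact ⟨fun w' hw' => (h2 w hw).of_left (h2 w' hw'),
      (Option.some_injective _ h).symm.trans (h2 w hw).verdict_eq⟩
  · simp at h

theorem announce_of_agree {a : ℕ} {K : Set World} {w : World} (hw : w ∈ K)
    (h : ∀ w' ∈ K, Agree a w w') : announce a K = some (verdict a w) := by
  have hex : (announce a K).isSome := by
    rw [announce, dif_pos ⟨w, hw, h⟩]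
    rfl
  obtain ⟨y, hy⟩ := Option.isSome_iff_exists.1 hex
  rw [hy, (announce_eq_some hw hy).2]

/-- The algorithm in which each node maintains the set of worlds that are compatible with what it
has learned, and stops as soon as all these worlds agree on the quantities that belong to it. -/
noncomputable def coverAlgorithm : LocalAlgorithm ℝ≥0 (Bool × ℝ) where
  State := ℕ × Set World
  Msg := ℕ × Set World
  init a x := (a, {w | w.2 a = x})
  send s := s
  receive s ms :=
    (s.1, {w | w ∈ s.2 ∧ (∀ m ∈ ms, w ∈ m.2) ∧ ∀ c, c ∈ w.1 s.1 ↔ ∃ m ∈ ms, m.1 = c})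
  output s := announce s.1 s.2

section

variable {V : Type} [Fintype V] (G : SimpleGraph V) [DecidableRel G.Adj]
  (ident : V → ℕ) (b : V → ℝ≥0)

/-- The sets of neighbours of a network, in terms of the identifiers. -/
noncomputable def identNbrs : ℕ → Finset ℕ :=
  Function.extend ident (fun v => (G.neighborFinset v).image ident) fun _ => ∅

/-- The world that describes a network and the bids of its nodes. -/
noncomputable def trueWorld : World := (identNbrs G ident, Function.extend ident b 0)

/-- The worlds that node `v` considers possible after `t` rounds. -/
noncomputable def possibleWorlds (t : ℕ) (v : V) : Set World :=
  (coverAlgorithm.run G ident b t v).2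

/-- After `t` rounds, every node `v` knows the property `P` of its identifier and the world. -/
def Knows (t : ℕ) (P : ℕ → World → Prop) : Prop :=
  ∀ v, ∀ w ∈ possibleWorlds G ident b t v, P (ident v) w

variable {G ident b}

theorem identNbrs_ident (hi : Function.Injective ident) (v : V) :
    identNbrs G ident (ident v) = (G.neighborFinset v).image ident :=
  hi.extend_apply _ _ v

theorem mem_identNbrs (hi : Function.Injective ident) {c d : ℕ} :
    c ∈ identNbrs G ident d ↔ ∃ u v, G.Adj u v ∧ ident u = c ∧ ident v = d := by
  by_cases hd : ∃ v, ident v = d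
  · obtain ⟨v, rfl⟩ := hd
    simp only [identNbrs_ident hi, Finset.mem_image, SimpleGraph.mem_neighborFinset]
    constructor
    · rintro ⟨u, hu, rfl⟩
      exact ⟨u, v, hu.symm, rfl, rfl⟩
    · rintro ⟨u, v', hu, rfl, hv⟩
      obtain rfl := hi hv
      exact ⟨u, hu.symm, rfl⟩
  · rw [identNbrs, Function.extend_apply' _ _ _ hd]
    simp only [Finset.notMem_empty, false_iff]
    rintro ⟨u, v, -, -, hv⟩
    exact hd ⟨v, hv⟩

theorem identNbrs_symm (hi : Function.Injective ident) (c d : ℕ)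
    (h : c ∈ identNbrs G ident d) : d ∈ identNbrs G ident c := by
  rw [mem_identNbrs hi] at h ⊢
  obtain ⟨u, v, h, hu, hv⟩ := h
  exact ⟨v, u, h.symm, hv, hu⟩

theorem card_identNbrs_le (hi : Function.Injective ident) (c : ℕ) :
    (identNbrs G ident c).card ≤ G.maxDegree := by
  by_cases hc : ∃ v, ident v = c
  · obtain ⟨v, rfl⟩ := hc
    rw [identNbrs_ident hi]
    exact Finset.card_image_le.trans (G.degree_le_maxDegree v)
  · rw [identNbrs, Function.extend_apply' _ _ _ hc]
    simp

theorem run_fst (t : ℕ) (v : V) : (coverAlgorithm.run G ident b t v).1 = ident v := by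
  induction t with
  | zero => rfl
  | succ t ih =>
    rw [LocalAlgorithm.run]
    split
    · exact ih
    · exact ih

theorem output_run (t : ℕ) (v : V) : coverAlgorithm.output (coverAlgorithm.run G ident b t v) =
    announce (ident v) (possibleWorlds G ident b t v) := by
  rw [← run_fst (G := G) (ident := ident) (b := b) t v]
  rfl

theorem possibleWorlds_succ (hi : Function.Injective ident) {t : ℕ} {v : V} :
    possibleWorlds G ident b (t + 1) v =
      if (announce (ident v) (possibleWorlds G ident b t v)).isSome then
        possibleWorlds G ident b t v
      else {w | w ∈ possibleWorlds G ident b t v ∧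
        (∀ u, G.Adj v u → w ∈ possibleWorlds G ident b t u) ∧
        w.1 (ident v) = identNbrs G ident (ident v)} := by
  rw [← output_run]
  unfold possibleWorlds
  rw [LocalAlgorithm.run]
  split
  · rfl
  · ext w
    refine and_congr Iff.rfl (and_congr ?_ ?_)
    · simp [coverAlgorithm]
    · rw [Finset.ext_iff]
      refine forall_congr' fun c => iff_congr ?_ ?_
      · rw [run_fst]
      · rw [identNbrs_ident hi]
        simp only [Finset.mem_image]
        constructor
        · rintro ⟨m, hm, hmc⟩
          obtain ⟨u, hu, rfl⟩ := Multiset.mem_map.1 hm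
          exact ⟨u, hu, (run_fst (G := G) (b := b) t u).symm.trans hmc⟩
        · rintro ⟨u, hu, rfl⟩
          exact ⟨_, Multiset.mem_map_of_mem _ hu, run_fst t u⟩

theorem trueWorld_mem (hi : Function.Injective ident) (t : ℕ) (v : V) :
    trueWorld G ident b ∈ possibleWorlds G ident b t v := by
  induction t generalizing v with
  | zero => exact hi.extend_apply _ _ v
  | succ t ih =>
    rw [possibleWorlds_succ hi]
    split
    · exact ih v
    · exact ⟨ih v, fun u _ => ih u, rfl⟩

theorem possibleWorlds_antitone (hi : Function.Injective ident) (v : V) :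
    Antitone fun t => possibleWorlds G ident b t v := by
  refine antitone_nat_of_succ_le fun t => ?_
  rw [possibleWorlds_succ hi]
  split
  · exact le_rfl
  · exact fun w hw => hw.1

theorem Knows.mono (hi : Function.Injective ident) {P : ℕ → World → Prop} {t t' : ℕ}
    (h : Knows G ident b t P) (htt : t ≤ t') : Knows G ident b t' P :=
  fun v w hw => h v w (possibleWorlds_antitone hi v htt hw)

/-- What holds for all nodes after a further round: nodes that have stopped know everything that
belongs to them, and the others combine what they and their neighbours knew. -/
theorem Knows.succ (hi : Function.Injective ident) {P Q : ℕ → World → Prop} {t : ℕ}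
    (h : Knows G ident b t P)
    (hA : ∀ v w, Agree (ident v) (trueWorld G ident b) w → Q (ident v) w)
    (hstep : ∀ v w, P (ident v) w →
      (trueWorld G ident b).1 (ident v) = w.1 (ident v) →
      (∀ c ∈ (trueWorld G ident b).1 (ident v), P c w) → Q (ident v) w) :
    Knows G ident b (t + 1) Q := by
  intro v w hw
  rw [possibleWorlds_succ hi] at hw
  split at hw
  · next hsome =>
    obtain ⟨y, hy⟩ := Option.isSome_iff_exists.1 hsome
    exact hA v w ((announce_eq_some (trueWorld_mem hi t v) hy).1 w hw)
  · refine hstep v w (h v w hw.1) hw.2.2.symm fun c hc => ?_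
    obtain ⟨u, v', huv, rfl, hv⟩ := (mem_identNbrs hi).1 hc
    obtain rfl := hi hv
    exact h u w (hw.2.1 u huv.symm)

end

/-! ### How knowledge spreads -/

/-- Node `a` knows its bid, its neighbours and its role in the forests. -/
structure KnowsLinks (w₀ : World) (a : ℕ) (w : World) : Prop where
  bid : w₀.2 a = w.2 a
  nbrs : w₀.1 a = w.1 a
  children : ∀ i, children w₀.1 i a = children w.1 i a

/-- Node `a` knows the colours that it computes in the first `t` reductions, and its level parity
if its level is at most `t`. -/
structure KnowsColorsUpTo (w₀ : World) (t a : ℕ) (w : World) : Prop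
    extends KnowsLinks w₀ a w where
  reducedColor : ∀ i r, r ≤ t → r ≤ level a → reducedColor w₀.1 i r a = reducedColor w.1 i r a
  levelParity : ∀ i, level a ≤ t → levelParity w₀.1 i a = levelParity w.1 i a

/-- Node `a` knows its colours and those of its parents. -/
structure KnowsColors (w₀ : World) (a : ℕ) (w : World) : Prop extends KnowsLinks w₀ a w where
  reducedColor : ∀ i t, t ≤ level a → reducedColor w₀.1 i t a = reducedColor w.1 i t a
  levelParity : ∀ i, levelParity w₀.1 i a = levelParity w.1 i a
  hostColor : ∀ i, (parent w₀.1 i a).map (color w₀.1 i) = (parent w.1 i a).map (color w.1 i)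

/-- Node `a` knows its part in the computation of the residual weights up to time `m`. -/
structure KnowsResid (w₀ : World) (m a : ℕ) (w : World) : Prop extends KnowsColors w₀ a w where
  resid : ∀ s z x, 2 * s ≤ m → resid w₀.1 (Function.update w₀.2 z x) s a =
    resid w.1 (Function.update w.2 z x) s a
  offer : ∀ s u z x, 2 * s + 1 ≤ m → offer w₀.1 (Function.update w₀.2 z x) s a u =
    offer w.1 (Function.update w.2 z x) s a u

theorem KnowsLinks.parent {w₀ w : World} {a : ℕ} (h : KnowsLinks w₀ a w) (i : ℕ) :
    parent w₀.1 i a = parent w.1 i a := parent_congr h.nbrs i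

theorem KnowsColors.color {w₀ w : World} {a : ℕ} (h : KnowsColors w₀ a w) (i : ℕ) :
    color w₀.1 i a = color w.1 i a := by
  rw [_root_.color, _root_.color, h.levelParity, h.reducedColor i _ le_rfl]

theorem KnowsColors.leaves {w₀ w : World} {a : ℕ} (h : KnowsColors w₀ a w) (s : ℕ) :
    leaves w₀.1 s a = leaves w.1 s a := by
  rw [_root_.leaves, _root_.leaves, h.color, h.children]

theorem KnowsColors.host {w₀ w : World} {a : ℕ} (h : KnowsColors w₀ a w) (s : ℕ) :
    host w₀.1 s a = host w.1 s a := by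
  have h1 := h.hostColor (s / 12)
  rw [_root_.host, _root_.host, ← h.parent]
  rw [← h.parent] at h1
  cases hp : _root_.parent w₀.1 (s / 12) a with
  | none => rfl
  | some p =>
    rw [hp] at h1
    simp only [Option.map_some, Option.some.injEq] at h1
    simp [Option.filter, h1]

theorem Agree.knowsLinks {w₀ w : World} {a : ℕ} (h : Agree a w₀ w) : KnowsLinks w₀ a w :=
  ⟨h.bid, h.nbrs, h.children⟩

theorem Agree.knowsColorsUpTo {w₀ w : World} {a : ℕ} (h : Agree a w₀ w) (t : ℕ) :
    KnowsColorsUpTo w₀ t a w :=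
  ⟨h.knowsLinks, fun i r _ hr => h.reducedColor i r hr, fun i _ => h.levelParity i⟩

theorem Agree.knowsColors {w₀ w : World} {a : ℕ} (h : Agree a w₀ w) : KnowsColors w₀ a w :=
  ⟨h.knowsLinks, h.reducedColor, h.levelParity, h.hostColor⟩

theorem Agree.knowsResid {w₀ w : World} {a : ℕ} (h : Agree a w₀ w) (m : ℕ) :
    KnowsResid w₀ m a w :=
  ⟨h.knowsColors, fun s z x _ => h.resid s z x, fun s u z x _ => h.offer s u z x⟩

/-- A reduction needs only the parent's previous colour. The parity needs the parent's parity only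
when the parent has a smaller level, hence one known a round earlier. -/
theorem KnowsColorsUpTo.succ {w₀ w : World} {t a : ℕ} (h : KnowsColorsUpTo w₀ t a w)
    (hc : ∀ c ∈ w₀.1 a, KnowsColorsUpTo w₀ t c w) : KnowsColorsUpTo w₀ (t + 1) a w := by
  refine ⟨h.toKnowsLinks, fun i r hr hl => ?_, fun i hl => ?_⟩
  · cases r with
    | zero => rfl
    | succ r =>
      rw [_root_.reducedColor, _root_.reducedColor, ← h.parent, h.reducedColor i r (by omega) (by omega)]
      split
      · next p hp =>
        split
        · next hlp =>
          rw [(hc p (parent_mem hp)).reducedColor i r (by omega) (by omega)]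
        · rfl
      · rfl
  · by_cases hx : ∃ p, parent w₀.1 i a = some p ∧ level p < level a
    · obtain ⟨p, hp, hlp⟩ := hx
      rw [levelParity_of_lt hp hlp, levelParity_of_lt (h.parent i ▸ hp) hlp,
        (hc p (parent_mem hp)).levelParity i (by omega)]
    · rw [levelParity_of_not_lt fun p hp hlp => hx ⟨p, hp, hlp⟩,
        levelParity_of_not_lt fun p hp hlp => hx ⟨p, (h.parent i).trans hp, hlp⟩]

theorem KnowsLinks.knowsColorsUpTo {w₀ w : World} {a : ℕ} (h : KnowsLinks w₀ a w) :
    KnowsColorsUpTo w₀ 0 a w := by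
  refine ⟨h, fun i r hr _ => ?_, fun i hl => ?_⟩
  · obtain rfl : r = 0 := by omega
    rfl
  · rw [levelParity_of_not_lt fun p _ => by omega, levelParity_of_not_lt fun p _ => by omega]

theorem KnowsColorsUpTo.knowsColors {w₀ w : World} {t a : ℕ} (h : KnowsColorsUpTo w₀ t a w)
    (ht : level a ≤ t) (hc : ∀ c ∈ w₀.1 a, KnowsColorsUpTo w₀ t c w) : KnowsColors w₀ a w := by
  refine ⟨h.toKnowsLinks, fun i r hr => h.reducedColor i r (by omega) hr,
    fun i => h.levelParity i ht, fun i => ?_⟩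
  rw [← h.parent]
  cases hp : parent w₀.1 i a with
  | none => rfl
  | some p =>
    have hpt : level p ≤ t := (level_mono (parent_lt hp).le).trans ht
    have hk := hc p (parent_mem hp)
    rw [Option.map_some, Option.map_some, color, color, hk.levelParity i hpt,
      hk.reducedColor i _ hpt le_rfl]

theorem KnowsColors.knowsResid {w₀ w : World} {a : ℕ} (h : KnowsColors w₀ a w) :
    KnowsResid w₀ 0 a w := by
  refine ⟨h, fun s z x hs => ?_, fun s u z x hs => by omega⟩
  obtain rfl : s = 0 := by omega
  simp only [resid, Function.update_apply, h.bid]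

/-- A slot takes two rounds: centres collect the residuals of their leaves and form the offers, then
the leaves learn their offers. -/
theorem KnowsResid.succ {w₀ w : World} {m a : ℕ} (h : KnowsResid w₀ m a w)
    (hc : ∀ c ∈ w₀.1 a, KnowsResid w₀ m c w) : KnowsResid w₀ (m + 1) a w := by
  have hleaf : ∀ s u, u ∈ leaves w₀.1 s a → u ∈ w₀.1 a := fun s u hu => (mem_leaves.1 hu).1
  refine ⟨h.toKnowsColors, fun s z x hs => ?_, fun s u z x hs => ?_⟩
  · cases s with
    | zero => exact h.resid 0 z x (by omega)
    | succ s =>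
      cases hh : host w₀.1 s a with
      | none =>
        rw [resid_succ_of_host_none hh, resid_succ_of_host_none (h.host s ▸ hh),
          h.resid s z x (by omega), ← h.leaves]
        congr 1
        exact Finset.sum_congr rfl fun u hu => (hc u (hleaf s u hu)).resid s z x (by omega)
      | some p =>
        rw [resid_succ_of_host hh, resid_succ_of_host (h.host s ▸ hh),
          h.resid s z x (by omega),
          (hc p (parent_mem (host_eq_some.1 hh).1)).offer s a z x (by omega)]
  · rw [_root_.offer, _root_.offer, h.resid s z x (by omega), ← h.leaves]
    congr 1
    exact Finset.sum_congr rfl fun v hv =>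
      (hc v (hleaf s v (Finset.mem_filter.1 hv).1)).resid s z x (by omega)

/-- Two rounds for each of `12 * D` slots; later forests are empty at `a`. The degree bound concerns
only `w₀`, and emptiness passes to `w` through the known links. -/
theorem KnowsResid.agree {w₀ w : World} {a D : ℕ} (h : KnowsResid w₀ (24 * D) a w)
    (hD : ∀ c, (w₀.1 c).card ≤ D) : Agree a w₀ w := by
  have hch : ∀ i, D ≤ i → children w₀.1 i a = ∅ := by
    intro i hi
    rw [children, Finset.filter_eq_empty_iff]
    intro u _ hu
    have := lt_card_of_parent hu
    have := hD u
    omega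
  have hpa : ∀ i, D ≤ i → parent w₀.1 i a = none := by
    intro i hi
    rw [Option.eq_none_iff_forall_ne_some]
    intro p hp
    have := lt_card_of_parent hp
    have := hD a
    omega
  have hch' : ∀ i, D ≤ i → children w.1 i a = ∅ := fun i hi => h.children i ▸ hch i hi
  have hpa' : ∀ i, D ≤ i → parent w.1 i a = none := fun i hi => h.parent i ▸ hpa i hi
  have hres : ∀ s z x, _root_.resid w₀.1 (Function.update w₀.2 z x) s a =
      _root_.resid w.1 (Function.update w.2 z x) s a := by
    intro s z x
    rcases le_total s (12 * D) with hs | hs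
    · exact h.resid s z x (by omega)
    · rw [resid_eq_of_inactive hch hpa hs, resid_eq_of_inactive hch' hpa' hs]
      exact h.resid _ z x (by omega)
  refine ⟨h.bid, h.nbrs, h.children, h.reducedColor, h.levelParity, h.hostColor, hres,
    fun s u z x => ?_⟩
  rcases lt_or_ge s (12 * D) with hs | hs
  · exact h.offer s u z x (by omega)
  · rw [offer_eq_of_inactive hch hs, offer_eq_of_inactive hch' hs, hres]

section

variable {V : Type} [Fintype V] {G : SimpleGraph V} [DecidableRel G.Adj]
  {ident : V → ℕ} {b : V → ℝ≥0}

theorem knows_links (hi : Function.Injective ident) :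
    Knows G ident b 2 (KnowsLinks (trueWorld G ident b)) := by
  have h0 : Knows G ident b 0 fun a w => (trueWorld G ident b).2 a = w.2 a := by
    intro v w hw
    exact (trueWorld_mem hi 0 v).trans (Eq.symm hw)
  have h1 : Knows G ident b 1 fun a w => (trueWorld G ident b).2 a = w.2 a ∧
      (trueWorld G ident b).1 a = w.1 a :=
    h0.succ hi (fun v w h => ⟨h.bid, h.nbrs⟩) fun v w h hn _ => ⟨h, hn⟩
  -- The second round brings the neighbours' own neighbour sets, which determine their parents.
  refine h1.succ hi (fun v w h => h.knowsLinks) fun v w h hn hc => ⟨h.1, hn, fun i => ?_⟩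
  rw [children, children, ← hn]
  exact Finset.filter_congr fun u hu => by rw [parent_congr (hc u hu).2]

theorem knows_colorsUpTo (hi : Function.Injective ident) (t : ℕ) :
    Knows G ident b (2 + t) (KnowsColorsUpTo (trueWorld G ident b) t) := by
  induction t with
  | zero => exact fun v w hw => (knows_links hi v w hw).knowsColorsUpTo
  | succ t ih =>
    exact ih.succ hi (fun v w h => h.knowsColorsUpTo _) fun v w h _ hc => h.succ hc

theorem knows_resid (hi : Function.Injective ident) {ℓ : ℕ} (hℓ : ∀ v, level (ident v) ≤ ℓ)
    (m : ℕ) : Knows G ident b (3 + ℓ + m) (KnowsResid (trueWorld G ident b) m) := by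
  induction m with
  | zero =>
    -- One more round, for the colours of the parents.
    have := (knows_colorsUpTo (G := G) (b := b) hi ℓ).succ hi
      (Q := KnowsColors (trueWorld G ident b)) (fun v w h => h.knowsColors)
      fun v w h _ hc => h.knowsColors (hℓ v) hc
    refine Knows.mono hi (fun v w hw => (this v w hw).knowsResid) (by omega)
  | succ m ih => exact ih.succ hi (fun v w h => h.knowsResid _) fun v w h _ hc => h.succ hc

theorem output_coverAlgorithm (hi : Function.Injective ident) {ℓ t : ℕ}
    (hℓ : ∀ v, level (ident v) ≤ ℓ) (ht : 3 + ℓ + 24 * G.maxDegree ≤ t) (v : V) :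
    coverAlgorithm.output (coverAlgorithm.run G ident b t v) =
      some (verdict (ident v) (trueWorld G ident b)) := by
  rw [output_run]
  refine announce_of_agree (trueWorld_mem hi t v) fun w hw => ?_
  exact ((knows_resid hi hℓ _).mono hi ht v w hw).agree (card_identNbrs_le hi)

/-! ### The mechanism and its properties -/

open Classical in
/-- The mechanism that the algorithm computes. -/
noncomputable def coverMechanism (G : SimpleGraph V) [DecidableRel G.Adj] (ident : V → ℕ) :
    SelectionMechanism V where
  select b := Finset.univ.filter fun v =>
    Selected (identNbrs G ident) (Function.extend ident b 0) (ident v)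
  pay b v := (verdict (ident v) (trueWorld G ident b)).2

theorem mem_select {v : V} : v ∈ (coverMechanism G ident).select b ↔
    Selected (identNbrs G ident) (Function.extend ident b 0) (ident v) := by
  simp [coverMechanism]

variable [DecidableEq V]

theorem extend_update (hi : Function.Injective ident) (b : V → ℝ≥0) (v : V) (x : ℝ≥0) :
    Function.extend ident (Function.update b v x) 0 =
      Function.update (Function.extend ident b 0) (ident v) x := by
  ext c
  by_cases hc : ∃ u, ident u = c
  · obtain ⟨u, rfl⟩ := hc
    rw [hi.extend_apply, Function.update_apply, Function.update_apply, hi.extend_apply]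
    simp only [hi.eq_iff]
  · have : c ≠ ident v := fun h => hc ⟨v, h.symm⟩
    rw [Function.extend_apply' _ _ _ hc, Function.update_of_ne this,
      Function.extend_apply' _ _ _ hc]

theorem coverMechanism_isMonotone (hi : Function.Injective ident) :
    (coverMechanism G ident).IsMonotone := by
  intro v b x h hx
  rw [mem_select] at h ⊢
  rw [extend_update hi]
  refine h.lower_bid (identNbrs_symm hi) ?_ fun c hc => Function.update_of_ne hc _ _
  rwa [Function.update_self, hi.extend_apply]

theorem coverMechanism_utility (hi : Function.Injective ident) (v : V) (y : ℝ≥0) (b : V → ℝ≥0) :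
    (coverMechanism G ident).utility v y b =
      if v ∈ (coverMechanism G ident).select b then
        ((sSup {x | v ∈ (coverMechanism G ident).select (Function.update b v x)} : ℝ≥0) : ℝ) - y
      else 0 := by
  have hT : {x | v ∈ (coverMechanism G ident).select (Function.update b v x)} =
      {x | Selected (identNbrs G ident)
        (Function.update (Function.extend ident b 0) (ident v) x) (ident v)} := by
    ext x
    rw [Set.mem_ofPred_eq, Set.mem_ofPred_eq, mem_select, extend_update hi]
  have hpay : (coverMechanism G ident).pay b v =
      (verdict (ident v) (trueWorld G ident b)).2 := rfl
  rw [SelectionMechanism.utility, hT, hpay]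
  by_cases h : v ∈ (coverMechanism G ident).select b
  · rw [if_pos h, if_pos h, verdict_snd_of_selected (mem_select.1 h), neg_add_eq_sub]
    rfl
  · rw [if_neg h, if_neg h, verdict_snd_of_not_selected (mt mem_select.2 h), add_zero]

theorem coverMechanism_isIncentiveCompatible (hi : Function.Injective ident) :
    (coverMechanism G ident).IsIncentiveCompatible := by
  intro v y b
  rw [coverMechanism_utility hi, coverMechanism_utility hi]
  simp only [Function.update_idem]
  set T := {x | v ∈ (coverMechanism G ident).select (Function.update b v x)} with hT
  have hbdd : BddAbove T := by
    -- This bound does not depend on the bid of `v`, since `v` is not its own neighbour.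
    refine ⟨∑ u ∈ identNbrs G ident (ident v), Function.extend ident b 0 u, fun x hx => ?_⟩
    rw [hT, Set.mem_ofPred_eq, mem_select, extend_update hi] at hx
    have := hx.le_sum (identNbrs_symm hi)
    rw [Function.update_self] at this
    refine this.trans_eq (Finset.sum_congr rfl fun u hu => Function.update_of_ne ?_ _ _)
    rintro rfl
    obtain ⟨u, u', huu, h1, h2⟩ := (mem_identNbrs hi).1 hu
    exact huu.ne (hi (h1.trans h2.symm))
  by_cases hy : v ∈ (coverMechanism G ident).select (Function.update b v y)
  · have h1 : (y : ℝ) ≤ (sSup T : ℝ≥0) := NNReal.coe_le_coe.2 (le_csSup hbdd hy)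
    rw [if_pos hy]
    split
    · exact le_rfl
    · linarith
  · have h1 : ((sSup T : ℝ≥0) : ℝ) ≤ y := by
      -- By monotonicity no winning bid exceeds a losing one. `T` may be empty; its supremum is then
      -- 0.
      refine NNReal.coe_le_coe.2 (csSup_le' fun x hx => ?_)
      by_contra! hlt
      have := coverMechanism_isMonotone hi v _ y hx (by simpa using hlt.le)
      rw [Function.update_idem] at this
      exact hy this
    rw [if_neg hy]
    split
    · linarith
    · exact le_rfl

theorem coverMechanism_isApprox (hi : Function.Injective ident) (w : V → ℝ≥0) :
    IsApproxMinVertexCover G w 2 ((coverMechanism G ident).select w) := by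
  have hs := identNbrs_symm (G := G) hi
  refine ⟨fun u v huv => ?_, fun S' hS' => ?_⟩
  · simp only [Finset.mem_coe, mem_select]
    rcases lt_or_gt_of_ne (hi.ne huv.ne) with h | h
    · exact (selected_of_adj hs ((mem_identNbrs hi).2 ⟨u, v, huv, rfl, rfl⟩) h).symm
    · exact selected_of_adj hs ((mem_identNbrs hi).2 ⟨v, u, huv.symm, rfl, rfl⟩) h
  · set β := Function.extend ident w 0 with hβ
    have hw : ∀ v, β (ident v) = w v := fun v => hi.extend_apply _ _ v
    -- Residuals never increase, so one slot late enough serves all of the finitely many selected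
    -- nodes.
    obtain ⟨s, hsel⟩ : ∃ s, ∀ v ∈ (coverMechanism G ident).select w,
        resid (identNbrs G ident) β s (ident v) = 0 := by
      have : ∀ v, ∃ s, v ∈ (coverMechanism G ident).select w →
          resid (identNbrs G ident) β s (ident v) = 0 := by
        intro v
        by_cases h : v ∈ (coverMechanism G ident).select w
        · obtain ⟨s, h'⟩ := mem_select.1 h
          exact ⟨s, fun _ => h'⟩
        · exact ⟨0, fun h' => absurd h' h⟩
      choose f hf using this
      refine ⟨Finset.univ.sup f, fun v hv => ?_⟩
      have := resid_antitone (identNbrs G ident) β (ident v)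
        (Finset.le_sup (f := f) (Finset.mem_univ v))
      simpa [hf v hv] using this
    obtain ⟨z, hz, hzs⟩ := exists_edge_packing hs β s
    have hsum : ∀ v, ∑ u ∈ identNbrs G ident (ident v), z (ident v) u =
        ∑ u ∈ G.neighborFinset v, z (ident v) (ident u) := fun v => by
      rw [identNbrs_ident hi, Finset.sum_image hi.injOn]
    refine sum_le_two_mul_sum_of_edge_packing G w (fun u v => z (ident u) (ident v))
      (fun u v => hz _ _) (fun v => ?_) _ S' (fun v hv => ?_) hS'
    · rw [← hsum, ← hw v, hzs (ident v)]
      exact le_add_self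
    · rw [← hsum, ← hw v, hzs (ident v), hsel v hv, zero_add]

end

theorem theorem5p1 (k : ℕ) :
    ∃ (A : LocalAlgorithm ℝ≥0 (Bool × ℝ)) (C : ℕ),
      ∀ (V : Type) [Fintype V] [DecidableEq V] (G : SimpleGraph V) [DecidableRel G.Adj]
        (ident : V → ℕ),
        Function.Injective ident →
        (∀ v, 1 ≤ ident v ∧ ident v ≤ k * Fintype.card V ^ k) →
        ∃ M : SelectionMechanism V,
          (∀ b : V → ℝ≥0,
            A.ComputesWithin G ident b (C * (G.maxDegree + logStar (Fintype.card V) + 1))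
              (fun v => (decide (v ∈ M.select b), M.pay b v))) ∧
          M.IsIncentiveCompatible ∧
          M.IsMonotone ∧
          ∀ w : V → ℝ≥0, IsApproxMinVertexCover G w 2 (M.select w) := by
  -- With `ℓ = log* n + colorDepth (2 ^ (4 * k + 4))` the time is `3 + ℓ + 24 * Δ`; the summand 24
  -- pays for the slots and for the 3 extra rounds.
  refine ⟨coverAlgorithm, colorDepth (2 ^ (4 * k + 4)) + 24, ?_⟩
  intro V _ _ G _ ident hi hk
  refine ⟨coverMechanism G ident, fun b v => ?_, coverMechanism_isIncentiveCompatible hi,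
    coverMechanism_isMonotone hi, coverMechanism_isApprox hi⟩
  have hn : 1 ≤ Fintype.card V := Fintype.card_pos_iff.2 ⟨v⟩
  rw [output_coverAlgorithm hi (ℓ := logStar (Fintype.card V) + colorDepth (2 ^ (4 * k + 4)))
    (fun u => (colorDepth_mono (by have := (hk u).2; omega)).trans (colorDepth_poly_le k _ hn))
    (by nlinarith)]
  refine congrArg some (Prod.ext (decide_eq_decide.2 mem_select.symm) rfl)
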